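/- Let $(\Omega,\mathcal A,\mathbb P)$ be a probability space, $T>0$, $L\in[0,T]$, and let $\gamma:[0,+\infty[\times\mathbb R\to\mathbb R$ be bounded and continuous. Let $\mathbb D=\mathbb D([0,T])$ be the space of càdlàg functions $[0,T]\to\mathbb R$ with the Skorokhod topology, given by the distance $$d(x,y)=\inf_{\lambda}\max\Big(\sup_{t}|\lambda(t)-t|,\ \sup_{t}|x(\lambda(t))-y(t)|\Big),$$ where $\lambda$ ranges over the increasing bijections of $[0,T]$. For a real-valued process $Y=(Y_t)_{t\in[0,T]}$ with càdlàg paths and a filtration $\mathcal G$, put $$\Gamma^{Y,\mathcal G}(L)=\sup_{\tau}\mathbb E[\gamma(\tau,Y_\tau)],$$ the supremum being over all $\mathcal G$-stopping times $\tau$ with $\tau\le L$. Let $X$ and $X^n$ ($n\in\mathbb N$) be real-valued processes on $(\Omega,\mathcal A,\mathbb P)$ indexed by $[0,T]$ with càdlàg paths, with natural filtrations $\mathcal F^X_t=\sigma(X_s,s\le t)$ and $\mathcal F^n_t=\sigma(X^n_s,s\le t)$, and let $\mathcal F$ be the right-continuous filtration associated with $\mathcal F^X$ ($\mathcal F_t=\bigcap_{s>t}\mathcal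 F^X_s$ for $t<T$, $\mathcal F_T=\mathcal F^X_T$). Assume that $\mathbb P[\Delta X_L\neq 0]=0$, where $\Delta X_t=X_t-X_{t-}$ and $X_{0-}=X_0$, and that $X^n\to X$ in probability for the Skorokhod topology, i.e. $\mathbb P[d(X^n,X)\ge\varepsilon]\to0$ for every $\varepsilon>0$. Then $$\Gamma^{X,\mathcal F^X}(L)\le\liminf_{n\to\infty}\Gamma^{X^n,\mathcal F^n}(L)\qquad\text{and}\qquad \Gamma^{X,\mathcal F}(L)\le\liminf_{n\to\infty}\Gamma^{X^n,\mathcal F^n}(L).$$ -/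

import Mathlib

open MeasureTheory Filter Topology Set
open scoped NNReal ENNReal BoundedContinuousFunction

noncomputable section

namespace OptimalStopping

/-- The space `𝔻([0, T])` of càdlàg functions from `[0, T]` to `ℝ`: right-continuous with left
limits. (Both conditions are void where there is nothing to the right, resp. to the left.) -/
structure Cadlag (T : ℝ) where
  toFun : Icc (0 : ℝ) T → ℝ
  right_cont : ∀ t, ContinuousWithinAt toFun (Ioi t) t
  left_lim : ∀ t, ∃ l : ℝ, Tendsto toFun (𝓝[<] t) (𝓝 l)

instance (T : ℝ) : CoeFun (Cadlag T) (fun _ => Icc (0 : ℝ) T → ℝ) := ⟨Cadlag.toFun⟩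

/-- The jump `Δx_t = x_t - x_{t-}`. `Function.leftLim` takes `x_{0-} = x_0`, so `Δx_0 = 0`. -/
def Cadlag.jump {T : ℝ} (x : Cadlag T) (t : Icc (0 : ℝ) T) : ℝ :=
  x t - Function.leftLim x t

/-- The Skorokhod (J1) distance on `𝔻([0, T])`:
`d(x, y) = inf_l max (sup_t |l(t) - t|) (sup_t |x(l(t)) - y(t)|)`, where `l` ranges over the
increasing bijections (time changes) of `[0, T]`. -/
def skorokhodEDist {T : ℝ} (x y : Cadlag T) : ℝ≥0∞ :=
  ⨅ l : Icc (0 : ℝ) T ≃o Icc (0 : ℝ) T,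
    max (⨆ t, edist (l t) t) (⨆ t, edist (x (l t)) (y t))

theorem skorokhodEDist_self {T : ℝ} (x : Cadlag T) : skorokhodEDist x x = 0 := by
  refine le_antisymm (iInf_le_of_le (OrderIso.refl _) ?_) bot_le
  simp

theorem skorokhodEDist_comm_le {T : ℝ} (x y : Cadlag T) :
    skorokhodEDist x y ≤ skorokhodEDist y x := by
  refine le_iInf fun l => iInf_le_of_le l.symm (max_le_max ?_ ?_)
  · refine iSup_le fun t => le_iSup_of_le (l.symm t) ?_
    rw [l.apply_symm_apply, edist_comm]
  · refine iSup_le fun t => le_iSup_of_le (l.symm t) ?_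
    rw [l.apply_symm_apply, edist_comm]

theorem skorokhodEDist_triangle {T : ℝ} (x y z : Cadlag T) :
    skorokhodEDist x z ≤ skorokhodEDist x y + skorokhodEDist y z := by
  unfold skorokhodEDist
  rw [ENNReal.iInf_add]
  refine le_iInf fun l => ?_
  rw [ENNReal.add_iInf]
  refine le_iInf fun k => iInf_le_of_le (k.trans l) (max_le ?_ ?_)
  · refine iSup_le fun t => (edist_triangle _ (k t) _).trans (add_le_add ?_ ?_)
    · exact le_max_of_le_left (le_iSup_of_le (k t) le_rfl)
    · exact le_max_of_le_left (le_iSup_of_le t le_rfl)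
  · refine iSup_le fun t => (edist_triangle _ (y (k t)) _).trans (add_le_add ?_ ?_)
    · exact le_max_of_le_right (le_iSup_of_le (k t) le_rfl)
    · exact le_max_of_le_right (le_iSup_of_le t le_rfl)

/-- The space of càdlàg functions with the Skorokhod topology. -/
instance (T : ℝ) : PseudoEMetricSpace (Cadlag T) where
  edist := skorokhodEDist
  edist_self := skorokhodEDist_self
  edist_comm x y := le_antisymm (skorokhodEDist_comm_le x y) (skorokhodEDist_comm_le y x)
  edist_triangle := skorokhodEDist_triangle

/-- The natural filtration `𝓕^X_t = σ(X_s, s ≤ t)` of a process with càdlàg paths. -/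
def naturalFiltration {Ω : Type*} [mΩ : MeasurableSpace Ω] {T : ℝ} (X : Ω → Cadlag T)
    (hX : ∀ t, StronglyMeasurable fun ω => X ω t) : Filtration (Icc (0 : ℝ) T) mΩ :=
  Filtration.natural (fun t ω => X ω t) hX

/-- The set of the numbers `𝔼[γ(τ, X_τ)]`, for `τ` an `𝓕`-stopping time bounded by `L`. -/
def stoppingRewards {Ω : Type*} [mΩ : MeasurableSpace Ω] (μ : Measure Ω) {T : ℝ}
    (γ : (ℝ≥0 × ℝ) →ᵇ ℝ) (L : Icc (0 : ℝ) T) (X : Ω → Cadlag T)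
    (𝓕 : Filtration (Icc (0 : ℝ) T) mΩ) : Set ℝ :=
  {r | ∃ τ : Ω → Icc (0 : ℝ) T,
    IsStoppingTime 𝓕 (fun ω => (τ ω : WithTop (Icc (0 : ℝ) T))) ∧ (∀ ω, τ ω ≤ L) ∧
      r = ∫ ω, γ (⟨τ ω, (τ ω).2.1⟩, X ω (τ ω)) ∂μ}

/-- The value in optimal stopping of horizon `L`: the supremum of `𝔼[γ(τ, X_τ)]` over the
`𝓕`-stopping times `τ` bounded by `L`. For a probability measure this is the supremum of a
non-empty set of reals bounded by `‖γ‖`. -/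
def optimalValue {Ω : Type*} [mΩ : MeasurableSpace Ω] (μ : Measure Ω) {T : ℝ}
    (γ : (ℝ≥0 × ℝ) →ᵇ ℝ) (L : Icc (0 : ℝ) T) (X : Ω → Cadlag T)
    (𝓕 : Filtration (Icc (0 : ℝ) T) mΩ) : ℝ :=
  sSup (stoppingRewards μ γ L X 𝓕)

end OptimalStopping

end

/-! Since `𝓕^X` is contained in its right-continuous version, only the second inequality needs an
argument, and a subsequence reduces it to almost sure Skorokhod convergence. Take a nearly optimal
`τ` and round it up to a finite grid, stopping at `L` at the latest. By right-continuity of paths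
and dominated convergence the reward changes little, and the rounded rule uses only the events `{τ <
s}`, which lie in `𝓕^X_s` although `τ` is merely an `𝓕`-stopping time.

The grid can consist of almost sure continuity times of `X`, because a càdlàg process has only
countably many fixed discontinuities. At such times, and at `L` by hypothesis, `X^n_s → X_s`. So the
rule, kept fixed, earns almost as much on `X^n` as on `X`.

It need not be a stopping time of `𝓕^n`. However, the events approximable in probability by events
of `𝓕^n_s` form a σ-algebra, and this contains `𝓕^X_s`
(`naturalFiltration_le_approximableSigmaAlgebra`). Replacing the finitely many events by
approximations gives an `𝓕^n`-stopping time that agrees with the rule off a small event. No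
convergence of filtrations is needed. -/

namespace OptimalStopping

variable {T : ℝ}

/-! ### Càdlàg paths: jumps and evaluation at continuity points. -/

namespace Cadlag

theorem tendsto_leftLim (x : Cadlag T) (t : Icc (0 : ℝ) T) :
    Tendsto x (𝓝[<] t) (𝓝 (Function.leftLim x t)) :=
  tendsto_leftLim_of_tendsto (x.left_lim t)

theorem continuousAt_of_jump_eq_zero (x : Cadlag T) {t : Icc (0 : ℝ) T} (h : x.jump t = 0) :
    ContinuousAt x t := by
  have hl : ContinuousWithinAt x (Iio t) t := by
    have := x.tendsto_leftLim t
    rwa [← sub_eq_zero.mp h] at this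
  exact continuousAt_iff_continuous_left'_right'.mpr ⟨hl, x.right_cont t⟩

/-- Just to the right of `t` the values lie in any given closed neighbourhood of `x t`, and so do
limits of such values. -/
theorem tendsto_leftLim_nhdsGT (x : Cadlag T) (t : Icc (0 : ℝ) T) :
    Tendsto (Function.leftLim x) (𝓝[>] t) (𝓝 (x t)) := by
  refine (closed_nhds_basis (x t)).tendsto_right_iff.mpr fun s hs => ?_
  have h := (x.right_cont t).tendsto.eventually_mem hs.1
  rw [← eventually_eventually_nhdsWithin] at h
  filter_upwards [h, self_mem_nhdsWithin] with r hr hrt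
  have hr' : ∀ᶠ u in 𝓝 r, x u ∈ s := by
    rwa [(isOpen_Ioi.nhdsWithin_eq hrt)] at hr
  rcases eq_or_neBot (𝓝[<] r) with hb | hb
  · rw [leftLim_eq_of_eq_bot _ hb]
    exact hr'.self_of_nhds
  · exact hs.2.mem_of_tendsto (x.tendsto_leftLim r) (hr'.filter_mono nhdsWithin_le_nhds)

/-- The jumps of a càdlàg function vanish in the limit at every punctured neighbourhood. -/
theorem tendsto_jump_nhdsNE (x : Cadlag T) (t : Icc (0 : ℝ) T) :
    Tendsto x.jump (𝓝[≠] t) (𝓝 0) := by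
  change Tendsto (fun s => x s - Function.leftLim x s) (𝓝[≠] t) (𝓝 0)
  rw [← nhdsLT_sup_nhdsGT]
  refine Tendsto.sup ?_ ?_
  · have h := (continuousWithinAt_leftLim_Iic (x.tendsto_leftLim t)).tendsto.mono_left
      (nhdsWithin_mono t Iio_subset_Iic_self)
    simpa only [sub_self] using (x.tendsto_leftLim t).sub h
  · simpa only [sub_self] using (x.right_cont t).tendsto.sub (x.tendsto_leftLim_nhdsGT t)

/-- Skorokhod convergence entails convergence of the values at the continuity points of the
limit. -/
theorem tendsto_apply_of_continuousAt {ι : Type*} {l : Filter ι} {y : ι → Cadlag T}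
    {x : Cadlag T} (hy : Tendsto y l (𝓝 x)) {t : Icc (0 : ℝ) T} (hx : ContinuousAt x t) :
    Tendsto (fun i => y i t) l (𝓝 (x t)) := by
  rw [EMetric.tendsto_nhds]
  intro ε hε
  have hε2 : 0 < ε / 2 := ENNReal.half_pos hε.ne'
  obtain ⟨δ, hδ, hδx⟩ := EMetric.tendsto_nhds_nhds.mp hx (ε / 2) hε2
  filter_upwards [EMetric.tendsto_nhds.mp hy (min δ (ε / 2)) (lt_min hδ hε2)] with i hi
  obtain ⟨k, hk⟩ := iInf_lt_iff.mp (show skorokhodEDist (y i) x < _ from hi)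
  rw [max_lt_iff] at hk
  -- Evaluating at `k.symm t` compares `y i t` with `x` at a time close to `t`, where continuity of
  -- `x` applies.
  have h1 := (le_iSup (fun s => edist (k s) s) (k.symm t)).trans_lt hk.1
  have h2 := (le_iSup (fun s => edist (y i (k s)) (x s)) (k.symm t)).trans_lt hk.2
  simp only [k.apply_symm_apply] at h1 h2
  rw [edist_comm] at h1
  calc edist (y i t) (x t) ≤ edist (y i t) (x (k.symm t)) + edist (x (k.symm t)) (x t) :=
        edist_triangle _ _ _
    _ < ε / 2 + ε / 2 :=
        ENNReal.add_lt_add (h2.trans_le (min_le_right _ _)) (hδx (h1.trans_le (min_le_left _ _)))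
    _ = ε := ENNReal.add_halves ε

end Cadlag

/-! ### Fixed times of discontinuity. -/

section FixedJumps

variable {Ω : Type*} [MeasurableSpace Ω]

theorem measurable_jump {X : Ω → Cadlag T} (hX : ∀ t, StronglyMeasurable fun ω => X ω t)
    (t : Icc (0 : ℝ) T) : Measurable fun ω => (X ω).jump t := by
  refine (hX t).measurable.sub ?_
  rcases eq_or_neBot (𝓝[<] t) with hb | hb
  · simpa only [leftLim_eq_of_eq_bot _ hb] using (hX t).measurable
  · exact measurable_of_tendsto_metrizable' (𝓝[<] t) (fun s => (hX s).measurable)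
      (tendsto_pi_nhds.mpr fun ω => (X ω).tendsto_leftLim t)

/-- A process with càdlàg paths has at most countably many fixed times of discontinuity. -/
theorem countable_setOf_not_ae_jump_eq_zero (μ : Measure Ω) [IsFiniteMeasure μ]
    {X : Ω → Cadlag T} (hX : ∀ t, StronglyMeasurable fun ω => X ω t) :
    {t | ¬ ∀ᵐ ω ∂μ, (X ω).jump t = 0}.Countable := by
  -- Truncation permits dominated convergence, so `g` tends to 0 at every punctured neighbourhood;
  -- by compactness each level set `{g ≥ 1/(n+1)}` is then finite.
  set g : Icc (0 : ℝ) T → ℝ := fun t => ∫ ω, min 1 |(X ω).jump t| ∂μ with hg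
  have hmeas : ∀ t, Measurable fun ω => min 1 |(X ω).jump t| := fun t =>
    measurable_const.min (measurable_jump hX t).abs
  have hb : ∀ t, ∀ᵐ ω ∂μ, ‖min 1 |(X ω).jump t|‖ ≤ (1 : ℝ) := fun t => ae_of_all _ fun ω => by
    rw [Real.norm_eq_abs, abs_of_nonneg (by positivity)]
    exact min_le_left _ _
  have hlim : ∀ t, Tendsto g (𝓝[≠] t) (𝓝 0) := by
    intro t
    have := tendsto_integral_filter_of_dominated_convergence (μ := μ) (l := 𝓝[≠] t)
      (F := fun s ω => min 1 |(X ω).jump s|) (f := fun _ => 0) (fun _ => (1 : ℝ))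
      (Eventually.of_forall fun s => (hmeas s).aestronglyMeasurable)
      (Eventually.of_forall hb) (integrable_const _)
      (ae_of_all _ fun ω => by
        simpa using (tendsto_const_nhds (x := (1 : ℝ))).min ((X ω).tendsto_jump_nhdsNE t).abs)
    simpa using this
  have hfin : ∀ n : ℕ, {t | 1 / ((n : ℝ) + 1) ≤ g t}.Finite := by
    intro n
    by_contra hinf
    obtain ⟨t, -, ht⟩ := Set.Infinite.exists_accPt_of_subset_isCompact hinf
      (isCompact_univ (X := Icc (0 : ℝ) T)) (subset_univ _)
    have h1 : ∀ᶠ s in 𝓝[≠] t, g s < 1 / ((n : ℝ) + 1) :=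
      (hlim t).eventually (gt_mem_nhds (by positivity))
    obtain ⟨s, hs1, hs2⟩ := (accPt_iff_frequently_nhdsNE.mp ht).and_eventually h1 |>.exists
    exact absurd hs2 (not_lt.mpr hs1)
  refine (countable_iUnion fun n => (hfin n).countable).mono fun t ht => ?_
  have hpos : 0 < g t := by
    refine lt_of_le_of_ne (integral_nonneg fun ω => by positivity) fun h0 => ht ?_
    have hint : Integrable (fun ω => min 1 |(X ω).jump t|) μ :=
      Integrable.of_bound (hmeas t).aestronglyMeasurable 1 (hb t)
    filter_upwards [(integral_eq_zero_iff_of_nonneg (fun ω => by positivity) hint).mp h0.symm]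
      with ω hω
    by_contra hne
    have : 0 < min 1 |(X ω).jump t| := lt_min one_pos (abs_pos.mpr hne)
    exact this.ne' hω
  obtain ⟨n, hn⟩ := exists_nat_one_div_lt hpos
  exact mem_iUnion.mpr ⟨n, hn.le⟩

/-- The times at which a càdlàg process is almost surely continuous are dense. -/
theorem dense_setOf_ae_jump_eq_zero (hT : 0 < T) (μ : Measure Ω) [IsFiniteMeasure μ]
    {X : Ω → Cadlag T} (hX : ∀ t, StronglyMeasurable fun ω => X ω t) :
    Dense {t | ∀ᵐ ω ∂μ, (X ω).jump t = 0} := by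
  have : Nontrivial (Icc (0 : ℝ) T) :=
    ⟨⟨⟨0, le_rfl, hT.le⟩, ⟨T, hT.le, le_rfl⟩, fun h => hT.ne (congrArg Subtype.val h)⟩⟩
  refine dense_of_exists_between fun a b hab => ?_
  by_contra! h
  have hsub : Ioo (a : ℝ) b ⊆ Subtype.val '' {t | ¬ ∀ᵐ ω ∂μ, (X ω).jump t = 0} := by
    intro r hr
    refine ⟨⟨r, a.2.1.trans hr.1.le, hr.2.le.trans b.2.2⟩, fun hae => ?_, rfl⟩
    exact h _ hae ⟨hr.1, hr.2⟩
  have hc := ((countable_setOf_not_ae_jump_eq_zero μ hX).image Subtype.val).mono hsub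
  exact absurd hc (by
    rw [← Cardinal.le_aleph0_iff_set_countable, Cardinal.mk_Ioo_real hab, not_le]
    exact Cardinal.aleph0_lt_continuum)

end FixedJumps

end OptimalStopping

namespace OptimalStopping

variable {T : ℝ}

/-! ### Approximating events of the limit's past. -/

section Approximation

variable {Ω : Type*} [mΩ : MeasurableSpace Ω]

/-- The `σ`-algebra of the events that are, up to small probability and for large `n`,
events of `𝓖 n`. -/
@[reducible]
def approximableSigmaAlgebra (μ : Measure Ω) [IsFiniteMeasure μ] (𝓖 : ℕ → MeasurableSpace Ω) :
    MeasurableSpace Ω where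
  MeasurableSet' A := MeasurableSet A ∧ ∀ ε : ℝ≥0∞, 0 < ε → ∃ B : ℕ → Set Ω,
    (∀ n, MeasurableSet[𝓖 n] (B n)) ∧ ∀ᶠ n in atTop, μ (symmDiff A (B n)) < ε
  measurableSet_empty := ⟨.empty, fun ε hε => ⟨fun _ => ∅, fun n => @MeasurableSet.empty _ (𝓖 n),
    by simp [hε]⟩⟩
  measurableSet_compl A hA := ⟨hA.1.compl, fun ε hε => by
    obtain ⟨B, hB, h⟩ := hA.2 ε hε
    exact ⟨fun n => (B n)ᶜ, fun n => (hB n).compl, by simpa only [compl_symmDiff_compl] using h⟩⟩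
  measurableSet_iUnion A hA := ⟨.iUnion fun i => (hA i).1, fun ε hε => by
    have htail : Tendsto (fun N => μ ((⋃ i, A i) \ ⋃ i ∈ Finset.range N, A i)) atTop (𝓝 0) := by
      have h := tendsto_measure_iInter_atTop (μ := μ)
        (s := fun N => (⋃ i, A i) \ ⋃ i ∈ Finset.range N, A i)
        (fun N => ((MeasurableSet.iUnion fun i => (hA i).1).diff
          (Finset.measurableSet_biUnion _ fun i _ => (hA i).1)).nullMeasurableSet)
        (fun M N hMN => sdiff_subset_sdiff_right (biUnion_subset_biUnion_left fun i hi =>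
          Finset.mem_range.mpr ((Finset.mem_range.mp hi).trans_le hMN)))
        ⟨0, measure_ne_top _ _⟩
      have he : (⋂ N, (⋃ i, A i) \ ⋃ i ∈ Finset.range N, A i) = ∅ := by
        refine eq_empty_of_forall_notMem fun ω hω => ?_
        rw [mem_iInter] at hω
        obtain ⟨i, hi⟩ := mem_iUnion.mp (hω 0).1
        exact (hω (i + 1)).2 (mem_biUnion (Finset.mem_coe.mpr (Finset.self_mem_range_succ i)) hi)
      rwa [he, measure_empty] at h
    have hε2 : 0 < ε / 2 := ENNReal.half_pos hε.ne'
    -- Only finitely many sets can be approximated simultaneously for large `n`, hence the cut at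
    -- `N`, with the tail costing `ε / 2`.
    obtain ⟨N, hN⟩ := (htail.eventually (gt_mem_nhds hε2)).exists
    obtain ⟨δ, hδ, hδε⟩ := ENNReal.exists_pos_sum_of_countable' hε2.ne' ℕ
    choose B hB h using fun i => (hA i).2 (δ i) (hδ i)
    refine ⟨fun n => ⋃ i ∈ Finset.range N, B i n, fun n =>
      Finset.measurableSet_biUnion _ fun i _ => hB i n, ?_⟩
    filter_upwards [(Finset.eventually_all (Finset.range N)).mpr fun i _ => h i] with n hn
    have hsub : symmDiff (⋃ i, A i) (⋃ i ∈ Finset.range N, B i n) ⊆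
        ((⋃ i, A i) \ ⋃ i ∈ Finset.range N, A i) ∪
          ⋃ i ∈ Finset.range N, symmDiff (A i) (B i n) := by
      intro ω hω
      simp only [mem_symmDiff, mem_union, Set.mem_sdiff, mem_iUnion, exists_prop] at hω ⊢
      rcases hω with ⟨hω, hω'⟩ | ⟨⟨i, hi, hω⟩, hω'⟩
      · by_cases hc : ∃ i ∈ Finset.range N, ω ∈ A i
        · obtain ⟨i, hi, hiA⟩ := hc
          exact Or.inr ⟨i, hi, Or.inl ⟨hiA, fun hb => hω' ⟨i, hi, hb⟩⟩⟩
        · exact Or.inl ⟨hω, hc⟩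
      · exact Or.inr ⟨i, hi, Or.inr ⟨hω, fun ha => hω' ⟨i, ha⟩⟩⟩
    calc μ (symmDiff (⋃ i, A i) (⋃ i ∈ Finset.range N, B i n))
        ≤ μ ((⋃ i, A i) \ ⋃ i ∈ Finset.range N, A i)
          + μ (⋃ i ∈ Finset.range N, symmDiff (A i) (B i n)) :=
          (measure_mono hsub).trans (measure_union_le _ _)
      _ < ε / 2 + ε / 2 := ENNReal.add_lt_add hN <|
          (measure_biUnion_finset_le _ _).trans_lt <|
            (Finset.sum_le_sum fun i hi => (hn i hi).le).trans_lt <|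
              (ENNReal.sum_le_tsum _).trans_lt hδε
      _ = ε := ENNReal.add_halves ε⟩

/-- An almost sure limit of `𝓖 n`-measurable random variables is measurable for the `σ`-algebra of
approximable events. -/
theorem measurable_approximableSigmaAlgebra (μ : Measure Ω) [IsFiniteMeasure μ]
    {𝓖 : ℕ → MeasurableSpace Ω} (h𝓖 : ∀ n, 𝓖 n ≤ mΩ) {Y : Ω → ℝ} (hY : Measurable Y)
    {Yn : ℕ → Ω → ℝ} (hYn : ∀ n, Measurable[𝓖 n] (Yn n))
    (hlim : ∀ᵐ ω ∂μ, Tendsto (fun n => Yn n ω) atTop (𝓝 (Y ω))) :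
    Measurable[approximableSigmaAlgebra μ 𝓖] Y := by
  refine @measurable_of_Ioi ℝ Ω _ _ _ (approximableSigmaAlgebra μ 𝓖) _ _ _ Y fun a => ?_
  refine ⟨hY measurableSet_Ioi, fun ε hε => ?_⟩
  have hε2 : 0 < ε / 2 := ENNReal.half_pos hε.ne'
  have hstrip : Tendsto (fun k : ℕ => μ (Y ⁻¹' Ioc a (a + 1 / ((k : ℝ) + 1)))) atTop (𝓝 0) := by
    have h := tendsto_measure_iInter_atTop (μ := μ)
      (s := fun k : ℕ => Y ⁻¹' Ioc a (a + 1 / ((k : ℝ) + 1)))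
      (fun k => (hY measurableSet_Ioc).nullMeasurableSet)
      (fun k l hkl => preimage_mono (Ioc_subset_Ioc_right
        (add_le_add_right (Nat.one_div_le_one_div hkl) a))) ⟨0, measure_ne_top _ _⟩
    have he : (⋂ k : ℕ, Y ⁻¹' Ioc a (a + 1 / ((k : ℝ) + 1))) = ∅ := by
      refine eq_empty_of_forall_notMem fun ω hω => ?_
      rw [mem_iInter] at hω
      obtain ⟨k, hk⟩ := exists_nat_one_div_lt (sub_pos.mpr (hω 0).1)
      have := (hω k).2
      linarith
    rwa [he, measure_empty] at h
  obtain ⟨k, hk⟩ := (hstrip.eventually (gt_mem_nhds hε2)).exists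
  have hc : (0 : ℝ) < 1 / ((k : ℝ) + 1) := by positivity
  set c : ℝ := 1 / ((k : ℝ) + 1)
  have hmeas : TendstoInMeasure μ Yn atTop Y :=
    tendstoInMeasure_of_tendsto_ae
      (fun n => ((hYn n).mono (h𝓖 n) le_rfl).aestronglyMeasurable) hlim
  rw [tendstoInMeasure_iff_dist] at hmeas
  -- The threshold is the middle of the strip `(a, a + c]`: if the two events disagree, either `Y`
  -- is in the strip or `Yn n` is at least `c / 2` away from `Y`.
  refine ⟨fun n => Yn n ⁻¹' Ioi (a + c / 2), fun n => hYn n measurableSet_Ioi, ?_⟩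
  filter_upwards [(hmeas (c / 2) (by positivity)).eventually (gt_mem_nhds hε2)] with n hn
  have hsub : symmDiff (Y ⁻¹' Ioi a) (Yn n ⁻¹' Ioi (a + c / 2)) ⊆
      Y ⁻¹' Ioc a (a + c) ∪ {ω | c / 2 ≤ dist (Yn n ω) (Y ω)} := by
    intro ω hω
    simp only [mem_symmDiff, mem_preimage, mem_Ioi, mem_union, mem_Ioc, mem_ofPred_eq,
      Real.dist_eq, not_lt] at hω ⊢
    by_contra! hcon
    obtain ⟨h1, h2⟩ := hcon
    rw [abs_lt] at h2
    rcases hω with ⟨h3, h4⟩ | ⟨h3, h4⟩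
    · have := h1 h3
      linarith
    · linarith
  calc _ ≤ _ := (measure_mono hsub).trans (measure_union_le _ _)
    _ < ε / 2 + ε / 2 := ENNReal.add_lt_add hk hn
    _ = ε := ENNReal.add_halves ε

/-- At a time `t` at which the limit has almost surely no jump, the events of the past of the
limit process are approximable by events of the past of the approximating processes. -/
theorem naturalFiltration_le_approximableSigmaAlgebra (hT : 0 < T) (μ : Measure Ω)
    [IsFiniteMeasure μ] {X : Ω → Cadlag T} (hX : ∀ t, StronglyMeasurable fun ω => X ω t)
    {Xn : ℕ → Ω → Cadlag T} (hXn : ∀ n t, StronglyMeasurable fun ω => Xn n ω t)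
    (hlim : ∀ᵐ ω ∂μ, Tendsto (fun n => Xn n ω) atTop (𝓝 (X ω)))
    {t : Icc (0 : ℝ) T} (ht : ∀ᵐ ω ∂μ, (X ω).jump t = 0) :
    naturalFiltration X hX t ≤
      approximableSigmaAlgebra μ fun n => naturalFiltration (Xn n) (hXn n) t := by
  have hcont : ∀ s ≤ t, (∀ᵐ ω ∂μ, (X ω).jump s = 0) →
      Measurable[approximableSigmaAlgebra μ fun n => naturalFiltration (Xn n) (hXn n) t]
        fun ω => X ω s := by
    intro s hst hs
    refine measurable_approximableSigmaAlgebra μ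
      (fun n => (naturalFiltration (Xn n) (hXn n)).le t) (hX s).measurable
      (Yn := fun n ω => Xn n ω s) (fun n => ?_) ?_
    · exact (comap_measurable _).mono
        (le_iSup₂_of_le (f := fun j (_ : j ≤ t) => MeasurableSpace.comap
          (fun ω => Xn n ω j) inferInstance) s hst le_rfl) le_rfl
    · filter_upwards [hlim, hs] with ω hω hsω
      exact Cadlag.tendsto_apply_of_continuousAt hω ((X ω).continuousAt_of_jump_eq_zero hsω)
  refine iSup₂_le fun s hst => ?_
  rw [← measurable_iff_comap_le]
  rcases hst.eq_or_lt with rfl | hst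
  · exact hcont s le_rfl ht
  -- A time `s < t` may be a fixed discontinuity; `X_s` is then a limit of `X_r` along continuity
  -- times `r ↓ s` that stay below `t`.
  have hD := dense_setOf_ae_jump_eq_zero hT μ hX
  have hne : (𝓝[>] s ⊓ 𝓟 ({r | ∀ᵐ ω ∂μ, (X ω).jump r = 0} ∩ Iio t)).NeBot := by
    refine ((nhdsGT_basis_of_exists_gt ⟨t, hst⟩).inf_principal_neBot_iff).mpr ?_
    intro u hu
    obtain ⟨r, hr, hsr, hru⟩ := hD.exists_between (lt_min hu hst)
    exact ⟨r, ⟨hsr, hru.trans_le (min_le_left _ _)⟩, hr, hru.trans_le (min_le_right _ _)⟩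
  obtain ⟨r, hr⟩ := exists_seq_tendsto (𝓝[>] s ⊓ 𝓟 ({r | ∀ᵐ ω ∂μ, (X ω).jump r = 0} ∩ Iio t))
  obtain ⟨hr1, hr2⟩ := tendsto_inf.mp hr
  rw [tendsto_principal] at hr2
  obtain ⟨N, hN⟩ := eventually_atTop.mp hr2
  refine @measurable_of_tendsto_metrizable Ω ℝ (_) _ _ _ _ (fun k ω => X ω (r (k + N))) _
    (fun k => hcont _ (hN _ (Nat.le_add_left _ _)).2.le (hN _ (Nat.le_add_left _ _)).1) ?_
  exact tendsto_pi_nhds.mpr fun ω =>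
    ((X ω).right_cont s).tendsto.comp (hr1.comp (tendsto_add_atTop_nat N))

end Approximation

end OptimalStopping

namespace OptimalStopping

variable {T : ℝ}

/-! ### Stopping rules on a finite grid. -/

section GridTime

variable {Ω : Type*} {ι : Type*} [LinearOrder ι]

open scoped Classical in
/-- The first time `s` of the finite grid `S` at which the event `B s` occurs, stopped at `L`. -/
noncomputable def gridTime (L : ι) (S : Finset ι) (B : ι → Set Ω) (ω : Ω) : ι :=
  (insert L (S.filter fun s => ω ∈ B s)).min' (Finset.insert_nonempty _ _)

theorem gridTime_le_iff {L : ι} {S : Finset ι} {B : ι → Set Ω} {ω : Ω} {t : ι} :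
    gridTime L S B ω ≤ t ↔ L ≤ t ∨ ∃ s ∈ S, s ≤ t ∧ ω ∈ B s := by
  classical
  constructor
  · intro h
    have hmem := Finset.min'_mem (insert L (S.filter fun s => ω ∈ B s))
      (Finset.insert_nonempty _ _)
    rcases Finset.mem_insert.mp hmem with h1 | h1
    · exact Or.inl (h1 ▸ h)
    · exact Or.inr ⟨_, (Finset.mem_filter.mp h1).1, h, (Finset.mem_filter.mp h1).2⟩
  · rintro (h | ⟨s, hs, hst, hB⟩)
    · exact (Finset.min'_le _ _ (Finset.mem_insert_self _ _)).trans h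
    · exact (Finset.min'_le _ _
        (Finset.mem_insert_of_mem (Finset.mem_filter.mpr ⟨hs, hB⟩))).trans hst

theorem gridTime_le (L : ι) (S : Finset ι) (B : ι → Set Ω) (ω : Ω) : gridTime L S B ω ≤ L :=
  gridTime_le_iff.mpr (Or.inl le_rfl)

theorem lt_gridTime_iff {L : ι} {S : Finset ι} {B : ι → Set Ω} {ω : Ω} {t : ι} :
    t < gridTime L S B ω ↔ t < L ∧ ∀ s ∈ S, ω ∈ B s → t < s := by
  rw [← not_le, gridTime_le_iff]
  push Not
  exact and_congr_right fun _ => forall₂_congr fun s _ =>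
    ⟨fun h hB => lt_of_not_ge fun hst => h hst hB, fun h hst hB => absurd (h hB) hst.not_gt⟩

theorem gridTime_mem (L : ι) (S : Finset ι) (B : ι → Set Ω) (ω : Ω) :
    gridTime L S B ω ∈ insert L S := by
  classical
  have hmem := Finset.min'_mem (insert L (S.filter fun s => ω ∈ B s))
    (Finset.insert_nonempty _ _)
  rcases Finset.mem_insert.mp hmem with h1 | h1
  · exact Finset.mem_insert.mpr (Or.inl h1)
  · exact Finset.mem_insert_of_mem (Finset.mem_filter.mp h1).1

theorem gridTime_congr {L : ι} {S : Finset ι} {B B' : ι → Set Ω} {ω : Ω}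
    (h : ∀ s ∈ S, ω ∈ B s ↔ ω ∈ B' s) : gridTime L S B ω = gridTime L S B' ω := by
  refine eq_of_forall_ge_iff fun t => ?_
  rw [gridTime_le_iff, gridTime_le_iff]
  exact or_congr_right (exists_congr fun s => and_congr_right fun hs =>
    and_congr_right fun _ => h s hs)

theorem isStoppingTime_gridTime [mΩ : MeasurableSpace Ω] {𝓕 : Filtration ι mΩ} (L : ι)
    {S : Finset ι} {B : ι → Set Ω} (hB : ∀ s ∈ S, MeasurableSet[𝓕 s] (B s)) :
    IsStoppingTime 𝓕 fun ω => ((gridTime L S B ω : ι) : WithTop ι) := by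
  intro t
  simp only [WithTop.coe_le_coe, gridTime_le_iff]
  have : {ω | L ≤ t ∨ ∃ s ∈ S, s ≤ t ∧ ω ∈ B s} =
      {_ω | L ≤ t} ∪ ⋃ s ∈ S.filter (· ≤ t), B s := by
    ext ω
    simp [and_assoc]
  rw [this]
  refine (MeasurableSet.const _).union (Finset.measurableSet_biUnion _ fun s hs => ?_)
  rw [Finset.mem_filter] at hs
  exact 𝓕.mono hs.2 _ (hB s hs.1)

end GridTime

/-! ### Rewards and elementary properties of the value. -/

section Reward

variable {Ω : Type*}

/-- The reward `γ(τ, X_τ)` of stopping at the random time `τ`. -/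
def reward (γ : (ℝ≥0 × ℝ) →ᵇ ℝ) (X : Ω → Cadlag T) (τ : Ω → Icc (0 : ℝ) T) (ω : Ω) : ℝ :=
  γ (⟨τ ω, (τ ω).2.1⟩, X ω (τ ω))

theorem norm_reward_le (γ : (ℝ≥0 × ℝ) →ᵇ ℝ) (X : Ω → Cadlag T) (τ : Ω → Icc (0 : ℝ) T) (ω : Ω) :
    ‖reward γ X τ ω‖ ≤ ‖γ‖ :=
  γ.norm_coe_le_norm _

theorem reward_congr (γ : (ℝ≥0 × ℝ) →ᵇ ℝ) (X : Ω → Cadlag T) {σ τ : Ω → Icc (0 : ℝ) T} {ω : Ω}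
    (h : σ ω = τ ω) : reward γ X σ ω = reward γ X τ ω := by
  simp only [reward, h]

theorem tendsto_reward {ι : Type*} {l : Filter ι} (γ : (ℝ≥0 × ℝ) →ᵇ ℝ) {Y : ι → Ω → Cadlag T}
    {X : Ω → Cadlag T} {σ : ι → Ω → Icc (0 : ℝ) T} {τ : Ω → Icc (0 : ℝ) T} {ω : Ω}
    (hσ : Tendsto (fun i => σ i ω) l (𝓝 (τ ω)))
    (hY : Tendsto (fun i => Y i ω (σ i ω)) l (𝓝 (X ω (τ ω)))) :
    Tendsto (fun i => reward γ (Y i) (σ i) ω) l (𝓝 (reward γ X τ ω)) := by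
  refine (γ.continuous.tendsto _).comp (Tendsto.prodMk_nhds ?_ hY)
  exact tendsto_subtype_rng.mpr ((continuous_subtype_val.tendsto (τ ω)).comp hσ)

variable [mΩ : MeasurableSpace Ω]

/-- As `τ` takes finitely many values, the reward is a finite sum over them, and no joint
measurability of `X` is involved. -/
theorem measurable_reward (γ : (ℝ≥0 × ℝ) →ᵇ ℝ) {X : Ω → Cadlag T}
    (hX : ∀ t, StronglyMeasurable fun ω => X ω t) {𝓕 : Filtration (Icc (0 : ℝ) T) mΩ}
    {τ : Ω → Icc (0 : ℝ) T}
    (hτ : IsStoppingTime 𝓕 fun ω => (τ ω : WithTop (Icc (0 : ℝ) T)))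
    {F : Finset (Icc (0 : ℝ) T)} (hF : ∀ ω, τ ω ∈ F) : Measurable (reward γ X τ) := by
  have hτm : Measurable τ := measurable_of_Iic fun t => by
    have := 𝓕.le t _ (hτ t)
    simp only [WithTop.coe_le_coe] at this
    exact this
  have hsum : reward γ X τ = fun ω =>
      ∑ s ∈ F, (τ ⁻¹' {s}).indicator (fun ω => γ (⟨s, s.2.1⟩, X ω s)) ω := by
    funext ω
    rw [Finset.sum_eq_single_of_mem (τ ω) (hF ω)]
    · rw [indicator_of_mem (by simp)]
      rfl
    · intro s _ hs
      exact indicator_of_notMem (fun h => hs h.symm) _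
  rw [hsum]
  refine Finset.measurable_sum _ fun s _ => Measurable.indicator ?_ (hτm (measurableSet_singleton s))
  exact γ.continuous.measurable.comp (measurable_const.prodMk (hX s).measurable)

theorem measurable_reward_gridTime (γ : (ℝ≥0 × ℝ) →ᵇ ℝ) {X : Ω → Cadlag T}
    (hX : ∀ t, StronglyMeasurable fun ω => X ω t) (L : Icc (0 : ℝ) T)
    {S : Finset (Icc (0 : ℝ) T)} {B : Icc (0 : ℝ) T → Set Ω} (hB : ∀ s ∈ S, MeasurableSet (B s)) :
    Measurable (reward γ X (gridTime L S B)) := by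
  -- For the constant filtration, adaptedness of the events is plain measurability.
  exact measurable_reward γ hX (𝓕 := Filtration.const _ mΩ le_rfl)
    (isStoppingTime_gridTime L hB) (gridTime_mem L S B)

theorem norm_integral_reward_le (μ : Measure Ω) [IsProbabilityMeasure μ] (γ : (ℝ≥0 × ℝ) →ᵇ ℝ)
    (X : Ω → Cadlag T) (τ : Ω → Icc (0 : ℝ) T) : ‖∫ ω, reward γ X τ ω ∂μ‖ ≤ ‖γ‖ := by
  simpa using norm_integral_le_of_norm_le_const (μ := μ) (ae_of_all _ (norm_reward_le γ X τ))

theorem bddAbove_stoppingRewards (μ : Measure Ω) [IsProbabilityMeasure μ] (γ : (ℝ≥0 × ℝ) →ᵇ ℝ)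
    (L : Icc (0 : ℝ) T) (X : Ω → Cadlag T) (𝓕 : Filtration (Icc (0 : ℝ) T) mΩ) :
    BddAbove (stoppingRewards μ γ L X 𝓕) := by
  refine ⟨‖γ‖, ?_⟩
  rintro r ⟨τ, -, -, rfl⟩
  exact (le_abs_self _).trans (norm_integral_reward_le μ γ X τ)

theorem stoppingRewards_nonempty (μ : Measure Ω) (γ : (ℝ≥0 × ℝ) →ᵇ ℝ)
    (L : Icc (0 : ℝ) T) (X : Ω → Cadlag T) (𝓕 : Filtration (Icc (0 : ℝ) T) mΩ) :
    (stoppingRewards μ γ L X 𝓕).Nonempty :=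
  ⟨_, fun _ => L, isStoppingTime_const 𝓕 L, fun _ => le_rfl, rfl⟩

theorem integral_reward_le_optimalValue (μ : Measure Ω) [IsProbabilityMeasure μ]
    (γ : (ℝ≥0 × ℝ) →ᵇ ℝ) {L : Icc (0 : ℝ) T} (X : Ω → Cadlag T)
    {𝓕 : Filtration (Icc (0 : ℝ) T) mΩ} {τ : Ω → Icc (0 : ℝ) T}
    (hτ : IsStoppingTime 𝓕 fun ω => (τ ω : WithTop (Icc (0 : ℝ) T))) (hL : ∀ ω, τ ω ≤ L) :
    ∫ ω, reward γ X τ ω ∂μ ≤ optimalValue μ γ L X 𝓕 :=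
  le_csSup (bddAbove_stoppingRewards μ γ L X 𝓕) ⟨τ, hτ, hL, rfl⟩

theorem optimalValue_le_norm (μ : Measure Ω) [IsProbabilityMeasure μ] (γ : (ℝ≥0 × ℝ) →ᵇ ℝ)
    (L : Icc (0 : ℝ) T) (X : Ω → Cadlag T) (𝓕 : Filtration (Icc (0 : ℝ) T) mΩ) :
    optimalValue μ γ L X 𝓕 ≤ ‖γ‖ := by
  refine csSup_le (stoppingRewards_nonempty μ γ L X 𝓕) ?_
  rintro r ⟨τ, -, -, rfl⟩
  exact (le_abs_self _).trans (norm_integral_reward_le μ γ X τ)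

/-- The value of a problem increases with the filtration. -/
theorem optimalValue_mono (μ : Measure Ω) [IsProbabilityMeasure μ] (γ : (ℝ≥0 × ℝ) →ᵇ ℝ)
    (L : Icc (0 : ℝ) T) (X : Ω → Cadlag T) {𝓕 𝓖 : Filtration (Icc (0 : ℝ) T) mΩ} (h : 𝓕 ≤ 𝓖) :
    optimalValue μ γ L X 𝓕 ≤ optimalValue μ γ L X 𝓖 := by
  refine csSup_le_csSup (bddAbove_stoppingRewards μ γ L X 𝓖)
    (stoppingRewards_nonempty μ γ L X 𝓕) ?_
  rintro r ⟨τ, hτ, hL, rfl⟩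
  exact ⟨τ, fun t => h t _ (hτ t), hL, rfl⟩

end Reward

/-! ### Rounding a stopping time up to a grid. -/

section Discretization

variable {Ω : Type*}

/-- For a stopping time of the right-continuous filtration, the event `{τ < s}` belongs to the
past of `s` in the original filtration. -/
theorem measurableSet_lt_of_isStoppingTime_rightCont [mΩ : MeasurableSpace Ω]
    {𝓕 : Filtration (Icc (0 : ℝ) T) mΩ}
    {τ : Ω → Icc (0 : ℝ) T}
    (hτ : IsStoppingTime 𝓕.rightCont fun ω => (τ ω : WithTop (Icc (0 : ℝ) T)))
    (s : Icc (0 : ℝ) T) : MeasurableSet[𝓕 s] {ω | τ ω < s} := by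
  by_cases hs : ∃ y, y < s
  · obtain ⟨y, hy⟩ := hs
    obtain ⟨u, -, hu, hlim⟩ := exists_seq_strictMono_tendsto' hy
    have heq : {ω | τ ω < s} = ⋃ k, {ω | τ ω ≤ u k} := by
      ext ω
      simp only [mem_ofPred_eq, mem_iUnion]
      refine ⟨fun h => ?_, fun ⟨k, hk⟩ => hk.trans_lt (hu k).2⟩
      exact ((hlim.eventually (lt_mem_nhds h)).exists).imp fun k hk => hk.le
    rw [heq]
    refine MeasurableSet.iUnion fun k => ?_
    have hk := hτ (u k)
    simp only [WithTop.coe_le_coe] at hk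
    -- Below the maximum, the right-continuous σ-algebra at `u k` is the intersection over later
    -- times, one of which is `s`.
    have : ¬ IsMax (u k) := not_isMax_iff.mpr ⟨s, (hu k).2⟩
    rw [Filtration.rightCont_eq_of_not_isMax _ this] at hk
    exact (iInf₂_le (f := fun j (_ : j > u k) => (𝓕 j : MeasurableSpace Ω)) s (hu k).2) _ hk
  · have : {ω | τ ω < s} = ∅ := eq_empty_of_forall_notMem fun ω hω => hs ⟨_, hω⟩
    rw [this]
    exact @MeasurableSet.empty _ (𝓕 s)

/-- Along finer and finer grids, the first grid point after `τ` (stopped at `L`) converges to `τ`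
from the right. -/
theorem tendsto_gridTime_setOf_lt (q : ℕ → Icc (0 : ℝ) T) (hq : DenseRange q)
    {τ : Ω → Icc (0 : ℝ) T} {L : Icc (0 : ℝ) T} (hL : ∀ ω, τ ω ≤ L) (ω : Ω) :
    Tendsto (fun m => gridTime L ((Finset.range m).image q) (fun s => {ω | τ ω < s}) ω) atTop
      (𝓝[≥] (τ ω)) := by
  have hge : ∀ m, τ ω ≤ gridTime L ((Finset.range m).image q) (fun s => {ω | τ ω < s}) ω := by
    intro m
    refine le_of_forall_lt fun t ht => lt_gridTime_iff.mpr ⟨ht.trans_le (hL ω), fun s _ hs => ?_⟩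
    exact ht.trans hs
  refine tendsto_nhdsWithin_iff.mpr ⟨tendsto_order.mpr ⟨fun a ha => ?_, fun b hb => ?_⟩,
    Eventually.of_forall hge⟩
  · exact Eventually.of_forall fun m => ha.trans_le (hge m)
  · rcases (hL ω).eq_or_lt with h | h
    · exact Eventually.of_forall fun m => (gridTime_le _ _ _ _).trans_lt (h ▸ hb)
    · obtain ⟨_, ⟨k, rfl⟩, hk1, hk2⟩ := hq.exists_between hb
      filter_upwards [eventually_gt_atTop k] with m hm
      refine (gridTime_le_iff.mpr (Or.inr ⟨q k, ?_, le_rfl, hk1⟩)).trans_lt hk2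
      exact Finset.mem_image_of_mem q (Finset.mem_range.mpr hm)

end Discretization

end OptimalStopping

/-! ### Lower semicontinuity of the value. -/

namespace OptimalStopping

variable {T : ℝ} {Ω : Type*} [mΩ : MeasurableSpace Ω]

/-- The reward of a stopping rule on a finite grid of almost sure continuity times is
asymptotically dominated by the values of the approximating problems. -/
theorem eventually_integral_reward_gridTime_lt (hT : 0 < T) (μ : Measure Ω)
    [IsProbabilityMeasure μ] {L : Icc (0 : ℝ) T} (γ : (ℝ≥0 × ℝ) →ᵇ ℝ) {X : Ω → Cadlag T}
    (hX : ∀ t, StronglyMeasurable fun ω => X ω t) {Xn : ℕ → Ω → Cadlag T}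
    (hXn : ∀ n t, StronglyMeasurable fun ω => Xn n ω t)
    (hlim : ∀ᵐ ω ∂μ, Tendsto (fun n => Xn n ω) atTop (𝓝 (X ω)))
    (hjump : ∀ᵐ ω ∂μ, (X ω).jump L = 0) {S : Finset (Icc (0 : ℝ) T)}
    (hS : ∀ s ∈ S, ∀ᵐ ω ∂μ, (X ω).jump s = 0) {B : Icc (0 : ℝ) T → Set Ω}
    (hB : ∀ s ∈ S, MeasurableSet[naturalFiltration X hX s] (B s)) {c : ℝ}
    (hc : c < ∫ ω, reward γ X (gridTime L S B) ω ∂μ) :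
    ∀ᶠ n in atTop, c < optimalValue μ γ L (Xn n) (naturalFiltration (Xn n) (hXn n)) := by
  set τ := gridTime L S B
  set ε : ℝ := ∫ ω, reward γ X τ ω ∂μ - c with hε
  have hε0 : 0 < ε := sub_pos.mpr hc
  have hBm : ∀ s ∈ S, MeasurableSet (B s) := fun s hs => (naturalFiltration X hX).le s _ (hB s hs)
  -- Chosen so that `S.card` errors of size `δ`, each weighted by `2 * ‖γ‖`, cost at most `ε / 2`;
  -- the `+ 1`s keep the denominator positive.
  set δ : ℝ := ε / (4 * (‖γ‖ + 1) * (S.card + 1)) with hδ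
  have hδ0 : 0 < δ := by positivity
  choose! A hA hAμ using fun s (hs : s ∈ S) =>
    (naturalFiltration_le_approximableSigmaAlgebra hT μ hX hXn hlim (hS s hs) _ (hB s hs)).2
      (ENNReal.ofReal δ) (ENNReal.ofReal_pos.mpr hδ0)
  have hAm : ∀ n, ∀ s ∈ S, MeasurableSet (A s n) := fun n s hs =>
    (naturalFiltration (Xn n) (hXn n)).le s _ (hA s hs n)
  have hconv : Tendsto (fun n => ∫ ω, reward γ (Xn n) τ ω ∂μ) atTop
      (𝓝 (∫ ω, reward γ X τ ω ∂μ)) := by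
    refine tendsto_integral_of_dominated_convergence (fun _ => ‖γ‖)
      (fun n => (measurable_reward_gridTime γ (hXn n) L hBm).aestronglyMeasurable)
      (integrable_const _) (fun n => ae_of_all _ (norm_reward_le γ (Xn n) τ)) ?_
    filter_upwards [hlim, hjump, (ae_ball_iff S.countable_toSet).mpr hS] with ω hω hL hSω
    refine tendsto_reward (σ := fun _ => τ) γ tendsto_const_nhds
      (Cadlag.tendsto_apply_of_continuousAt hω ((X ω).continuousAt_of_jump_eq_zero ?_))
    rcases Finset.mem_insert.mp (gridTime_mem L S B ω) with h | h
    -- The default value `L` of the rule is where the assumption on `ΔX_L` enters.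
    · rwa [← h] at hL
    · exact hSω _ h
  filter_upwards [hconv.eventually (lt_mem_nhds (show ∫ ω, reward γ X τ ω ∂μ - ε / 2 < _ by
    linarith)), (Finset.eventually_all S).mpr hAμ] with n hn hAn
  set σ := gridTime L S fun s => A s n
  set E : Set Ω := ⋃ s ∈ S, symmDiff (B s) (A s n)
  have hEm : MeasurableSet E :=
    Finset.measurableSet_biUnion _ fun s hs => (hBm s hs).symmDiff (hAm n s hs)
  have hEμ : μ.real E ≤ S.card * δ := by
    refine (measureReal_biUnion_finset_le S _).trans ?_
    rw [← nsmul_eq_mul]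
    refine Finset.sum_le_card_nsmul _ _ _ fun s hs => ?_
    exact ENNReal.toReal_le_of_le_ofReal hδ0.le (hAn s hs).le
  have hle : ∀ ω, reward γ (Xn n) τ ω ≤
      reward γ (Xn n) σ ω + E.indicator (fun _ => 2 * ‖γ‖) ω := by
    intro ω
    by_cases hω : ω ∈ E
    · rw [indicator_of_mem hω]
      have h1 := abs_le.mp (norm_reward_le γ (Xn n) τ ω)
      have h2 := abs_le.mp (norm_reward_le γ (Xn n) σ ω)
      linarith
    · have : τ ω = σ ω := gridTime_congr fun s hs => by
        by_contra hiff
        refine hω (mem_biUnion (Finset.mem_coe.mpr hs) ?_)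
        rw [mem_symmDiff]
        tauto
      rw [indicator_of_notMem hω, add_zero]
      exact (reward_congr γ (Xn n) this).le
  have hτint : Integrable (reward γ (Xn n) τ) μ :=
    .of_bound (measurable_reward_gridTime γ (hXn n) L hBm).aestronglyMeasurable ‖γ‖
      (ae_of_all _ (norm_reward_le γ (Xn n) τ))
  have hσint : Integrable (reward γ (Xn n) σ) μ :=
    .of_bound (measurable_reward_gridTime γ (hXn n) L (hAm n)).aestronglyMeasurable ‖γ‖
      (ae_of_all _ (norm_reward_le γ (Xn n) σ))
  have hEint : Integrable (E.indicator fun _ => 2 * ‖γ‖) μ := (integrable_const _).indicator hEm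
  have hint : ∫ ω, reward γ (Xn n) τ ω ∂μ ≤
      ∫ ω, reward γ (Xn n) σ ω ∂μ + μ.real E * (2 * ‖γ‖) := by
    refine (integral_mono hτint (hσint.add hEint) hle).trans_eq ?_
    rw [integral_add' hσint hEint, integral_indicator_const _ hEm, smul_eq_mul]
  have hσ : ∫ ω, reward γ (Xn n) σ ω ∂μ ≤
      optimalValue μ γ L (Xn n) (naturalFiltration (Xn n) (hXn n)) :=
    integral_reward_le_optimalValue μ γ (Xn n)
      (isStoppingTime_gridTime L fun s hs => hA s hs n) (gridTime_le L S _)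
  have hsmall : μ.real E * (2 * ‖γ‖) ≤ ε / 2 := by
    have hγ := norm_nonneg γ
    calc μ.real E * (2 * ‖γ‖) ≤ (S.card + 1) * δ * (2 * (‖γ‖ + 1)) := by
          gcongr
          · exact hEμ.trans (by gcongr; linarith)
          · linarith
      _ = ε / 2 := by
          rw [hδ]
          field_simp
          norm_num
  linarith

/-- Lower semicontinuity of the optimal stopping value under almost sure Skorokhod
convergence. -/
theorem eventually_lt_optimalValue_of_ae_tendsto (hT : 0 < T) (μ : Measure Ω)
    [IsProbabilityMeasure μ] {L : Icc (0 : ℝ) T} (γ : (ℝ≥0 × ℝ) →ᵇ ℝ) {X : Ω → Cadlag T}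
    (hX : ∀ t, StronglyMeasurable fun ω => X ω t) {Xn : ℕ → Ω → Cadlag T}
    (hXn : ∀ n t, StronglyMeasurable fun ω => Xn n ω t)
    (hlim : ∀ᵐ ω ∂μ, Tendsto (fun n => Xn n ω) atTop (𝓝 (X ω)))
    (hjump : ∀ᵐ ω ∂μ, (X ω).jump L = 0) {c : ℝ}
    (hc : c < optimalValue μ γ L X (naturalFiltration X hX).rightCont) :
    ∀ᶠ n in atTop, c < optimalValue μ γ L (Xn n) (naturalFiltration (Xn n) (hXn n)) := by
  obtain ⟨_, ⟨τ, hτ, hτL, rfl⟩, hcτ⟩ := exists_lt_of_lt_csSup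
    (stoppingRewards_nonempty μ γ L X _) hc
  obtain ⟨Q, hQ, hQc, hQd⟩ := (dense_setOf_ae_jump_eq_zero hT μ hX).exists_countable_dense_subset
  have : Nonempty (Icc (0 : ℝ) T) := ⟨L⟩
  obtain ⟨q, rfl⟩ := hQc.exists_eq_range hQd.nonempty
  have hB := measurableSet_lt_of_isStoppingTime_rightCont hτ
  set σ : ℕ → Ω → Icc (0 : ℝ) T := fun m =>
    gridTime L ((Finset.range m).image q) fun s => {ω | τ ω < s}
  have hconv : Tendsto (fun m => ∫ ω, reward γ X (σ m) ω ∂μ) atTop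
      (𝓝 (∫ ω, reward γ X τ ω ∂μ)) := by
    refine tendsto_integral_of_dominated_convergence (fun _ => ‖γ‖)
      (fun m => (measurable_reward_gridTime γ hX L
        fun s _ => (naturalFiltration X hX).le s _ (hB s)).aestronglyMeasurable)
      (integrable_const _) (fun m => ae_of_all _ (norm_reward_le γ X (σ m)))
      (ae_of_all _ fun ω => ?_)
    have h := tendsto_gridTime_setOf_lt q hQd hτL ω
    exact tendsto_reward (Y := fun _ => X) γ (h.mono_right nhdsWithin_le_nhds)
      -- The closed half-line is needed because the rounded time equals `τ` wherever `τ = L`.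
      ((continuousWithinAt_Ioi_iff_Ici.mp ((X ω).right_cont (τ ω))).tendsto.comp h)
  obtain ⟨m, hm⟩ := (hconv.eventually (lt_mem_nhds hcτ)).exists
  refine eventually_integral_reward_gridTime_lt hT μ γ hX hXn hlim hjump (fun s hs => ?_)
    (fun s _ => hB s) hm
  obtain ⟨k, -, rfl⟩ := Finset.mem_image.mp hs
  exact hQ (mem_range_self k)

/-- Lower semicontinuity of the optimal stopping value under Skorokhod convergence in
probability. -/
theorem optimalValue_rightCont_le_liminf (hT : 0 < T) (μ : Measure Ω)
    [IsProbabilityMeasure μ] {L : Icc (0 : ℝ) T} (γ : (ℝ≥0 × ℝ) →ᵇ ℝ) {X : Ω → Cadlag T}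
    (hX : ∀ t, StronglyMeasurable fun ω => X ω t) {Xn : ℕ → Ω → Cadlag T}
    (hXn : ∀ n t, StronglyMeasurable fun ω => Xn n ω t)
    (hjump : ∀ᵐ ω ∂μ, (X ω).jump L = 0) (hconv : TendstoInMeasure μ Xn atTop X) :
    optimalValue μ γ L X (naturalFiltration X hX).rightCont ≤
      liminf (fun n => optimalValue μ γ L (Xn n) (naturalFiltration (Xn n) (hXn n))) atTop := by
  by_contra! hlt
  obtain ⟨c, hc1, hc2⟩ := exists_between hlt
  have hcob : IsCoboundedUnder (· ≥ ·) atTop fun n =>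
      optimalValue μ γ L (Xn n) (naturalFiltration (Xn n) (hXn n)) :=
    isCoboundedUnder_ge_of_le atTop fun n => optimalValue_le_norm μ γ L (Xn n) _
  -- First fix a subsequence whose values all stay below `c`; a further one converging almost surely
  -- contradicts the almost sure case.
  obtain ⟨φ, hφ, hφc⟩ := extraction_of_frequently_atTop (frequently_lt_of_liminf_lt hcob hc1)
  obtain ⟨ψ, -, hψ⟩ := (hconv.comp hφ.tendsto_atTop).exists_seq_tendsto_ae
  obtain ⟨n, hn⟩ := (eventually_lt_optimalValue_of_ae_tendsto hT μ γ hX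
    (fun n => hXn (φ (ψ n))) hψ hjump hc2).exists
  exact lt_asymm hn (hφc (ψ n))

end OptimalStopping

theorem mainTheorem4 {Ω : Type*} [MeasurableSpace Ω] (μ : Measure Ω) [IsProbabilityMeasure μ]
    (T : ℝ) (hT : 0 < T) (L : Icc (0 : ℝ) T) (γ : (ℝ≥0 × ℝ) →ᵇ ℝ)
    (X : Ω → OptimalStopping.Cadlag T) (hX : ∀ t, StronglyMeasurable fun ω => X ω t)
    (Xn : ℕ → Ω → OptimalStopping.Cadlag T)
    (hXn : ∀ n t, StronglyMeasurable fun ω => Xn n ω t)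
    (hjump : μ {ω | (X ω).jump L ≠ 0} = 0)
    (hconv : TendstoInMeasure μ Xn atTop X) :
    OptimalStopping.optimalValue μ γ L X (OptimalStopping.naturalFiltration X hX) ≤
        liminf (fun n => OptimalStopping.optimalValue μ γ L (Xn n)
          (OptimalStopping.naturalFiltration (Xn n) (hXn n))) atTop ∧
      OptimalStopping.optimalValue μ γ L X (OptimalStopping.naturalFiltration X hX).rightCont ≤
        liminf (fun n => OptimalStopping.optimalValue μ γ L (Xn n)
          (OptimalStopping.naturalFiltration (Xn n) (hXn n))) atTop := by
  have h := OptimalStopping.optimalValue_rightCont_le_liminf hT μ γ hX hXn (ae_iff.mpr hjump) hconv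
  exact ⟨(OptimalStopping.optimalValue_mono μ γ L X (Filtration.le_rightCont _)).trans h, h⟩
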